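/- Let $\mathbb D=\{w\in\mathbb C:|w|<1\}$ and $\mathbb T=\{\zeta\in\mathbb C:|\zeta|=1\}$. For a finite complex Borel measure $\mu$ on $\mathbb T$, with total variation $\|\mu\|$, let $$(K\mu)(w)=\int_{\mathbb T}\frac{\mu(d\zeta)}{1-w\overline{\zeta}},\qquad w\in\mathbb D,$$ and let $\mathcal K$ be the set of all holomorphic functions $h$ on $\mathbb D$ with $h=K\mu$ for some such $\mu$; for $h\in\mathcal K$ put $\|h\|_{\mathcal K}=\inf\{\|\mu\| : K\mu=h\}$. For $h$ holomorphic on $\mathbb D$ let $(Bh)(w)=\frac{h(w)-h(0)}{w}$ (with $(Bh)(0)=h'(0)$). Inner products are linear in the first argument, and a contraction is a bounded linear operator $A$ with $\|A\|\le 1$. Let $h$ be holomorphic on $\mathbb D$ with $h(0)=1$. Then the following are equivalent: (i) $h\in\mathcal K$. (ii) There exist a complex separable Hilbert space $\mathcal H$, vectors $\phi,\psi\in\mathcal H$ and a contraction $A$ on $\mathcal H$ such that $$h(w)=1+w\langle (I-wA)^{-1}\phi,\psi\rangle_{\mathcal H},\qquad w\in\mathbb D.\tag{1}$$ (iii) There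 exist a complex separable Hilbert space $\mathcal H'$, vectors $\phi',\psi'\in\mathcal H'$ and a unitary operator $U$ on $\mathcal H'$ such that $$h(w)=1+w\langle (I-wU)^{-1}\phi',\psi'\rangle_{\mathcal H'},\qquad w\in\mathbb D.\tag{2}$$ Moreover, if $h\in\mathcal K$, then $Bh\in\mathcal K$ and $$\|Bh\|_{\mathcal K}=\min\|\phi\|_{\mathcal H}\|\psi\|_{\mathcal H}=\min\|\phi'\|_{\mathcal H'}\|\psi'\|_{\mathcal H'},$$ where the minima are attained and are taken over all representations of $h$ of the form (1) and (2), respectively. -/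

import Mathlib

open MeasureTheory

universe u

noncomputable section

/-- The open unit disk `𝔻`. -/
abbrev unitDisk : Set ℂ := Metric.ball 0 1

/-- The unit circle `𝕋`, with its subspace topology and Borel σ-algebra. -/
abbrev UnitCircle : Type := Metric.sphere (0 : ℂ) 1

/-- The total variation norm `‖μ‖ = |μ|(𝕋)` of a complex Borel measure on the circle;
it is finite by `variation_univ_ne_top`. -/
def totalVariationNorm (μ : ComplexMeasure UnitCircle) : ℝ :=
  (μ.variation Set.univ).toReal

/-- A complex measure has finite total variation. -/
theorem variation_univ_ne_top (μ : ComplexMeasure UnitCircle) :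
    μ.variation Set.univ ≠ ⊤ := by
  have h : μ.variation ≤
      (ComplexMeasure.re μ).totalVariation + (ComplexMeasure.im μ).totalVariation := by
    apply VectorMeasure.variation_le_of_forall_enorm_le
    intro E _
    have h1 := SignedMeasure.enorm_le_totalVariation (ComplexMeasure.re μ) E
    have h2 := SignedMeasure.enorm_le_totalVariation (ComplexMeasure.im μ) E
    have h3 : ‖μ E‖ₑ ≤ ‖(ComplexMeasure.re μ) E‖ₑ + ‖(ComplexMeasure.im μ) E‖ₑ := by
      have h4 : ‖μ E‖ₑ = ‖(((μ E).re : ℂ)) + ((μ E).im : ℂ) * Complex.I‖ₑ := by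
        rw [Complex.re_add_im]
      rw [h4]
      refine (enorm_add_le _ _).trans (le_of_eq ?_)
      simp only [← ofReal_norm, norm_mul, Complex.norm_I, mul_one, Complex.norm_real]
      rfl
    exact h3.trans (add_le_add h1 h2)
  exact ne_top_of_le_ne_top (measure_ne_top _ _) (h Set.univ)

/-- The Cauchy transform `(Kμ)(w) = ∫ μ(dζ) / (1 - w ζ̄)` of a complex Borel measure `μ` on `𝕋`. -/
def cauchyTransform (μ : ComplexMeasure UnitCircle) (w : ℂ) : ℂ :=
  μ.integral (fun ζ : UnitCircle => 1 / (1 - w * starRingEnd ℂ (ζ : ℂ)))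
    (ContinuousLinearMap.mul ℝ ℂ)

/-- The set `R_h` of all complex Borel measures `μ` on `𝕋` with `Kμ = h` on `𝔻`. -/
def representingMeasures (h : ℂ → ℂ) : Set (ComplexMeasure UnitCircle) :=
  {μ | ∀ w ∈ unitDisk, h w = cauchyTransform μ w}

/-- The class `𝒦` of Cauchy transforms: functions holomorphic on `𝔻` that are equal there to `Kμ`
for some `μ`. (Only the values on `𝔻` of a function `ℂ → ℂ` matter.) -/
def cauchySpace : Set (ℂ → ℂ) :=
  {h | DifferentiableOn ℂ h unitDisk ∧ (representingMeasures h).Nonempty}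

/-- The norm `‖h‖_𝒦 = inf {‖μ‖ : μ ∈ R_h}` of `h ∈ 𝒦`. -/
def cauchyNorm (h : ℂ → ℂ) : ℝ :=
  sInf (totalVariationNorm '' representingMeasures h)

/-- The backward shift `(Bh)(w) = (h(w) - h(0)) / w`, with the removable singularity at `0`
filled by `h'(0)`. -/
def backwardShift (h : ℂ → ℂ) (w : ℂ) : ℂ :=
  if w = 0 then deriv h 0 else (h w - h 0) / w

/-- `h(w) = 1 + w ⟨(I - wA)⁻¹ φ, ψ⟩` for all `w ∈ 𝔻`. The inner product of the text is linear in
its first argument, Mathlib's `inner ℂ x y` in its second, hence the order of the arguments. -/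
def IsRepresentedBy {H : Type*} [NormedAddCommGroup H] [InnerProductSpace ℂ H]
    (h : ℂ → ℂ) (A : H →L[ℂ] H) (φ ψ : H) : Prop :=
  ∀ w ∈ unitDisk, h w = 1 + w * inner ℂ ψ (Ring.inverse (1 - w • A) φ)

/-- The inverse in `IsRepresentedBy` is a genuine inverse when `A` is a contraction. -/
theorem isUnit_one_sub_smul {H : Type*} [NormedAddCommGroup H] [InnerProductSpace ℂ H]
    [CompleteSpace H] {A : H →L[ℂ] H} (hA : ‖A‖ ≤ 1) {w : ℂ} (hw : w ∈ unitDisk) :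
    IsUnit (1 - w • A) := by
  apply isUnit_one_sub_of_norm_lt_one
  have hw' : ‖w‖ < 1 := by simpa using hw
  calc ‖w • A‖ = ‖w‖ * ‖A‖ := norm_smul _ _
    _ ≤ ‖w‖ * 1 := by gcongr
    _ < 1 := by simpa using hw'

end

/-!
Write `⟨φ, ψ⟩` for the inner product that is linear in `φ`. The proof rests on the fact that
`h = 1 + w ⟨(1 - wA)⁻¹ φ, ψ⟩` on the disk says precisely that `Bh = ⟨(1 - wA)⁻¹ φ, ψ⟩` there, so
that everything is about representing the single function `Bh` either as a Cauchy transform `Kν`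
or as a matrix entry of the resolvent of a contraction.

*From operators to measures* (`exists_cauchyTransform_eq_inner`). A contraction dilates to a
unitary `U`, with the same resolvent matrix entries on the original space. The functional calculus
of `U` is a representation `π` of `C(𝕋)` with `π(conj ζ) = U`, hence
`π(1 / (1 - w conj ζ)) = (1 - wU)⁻¹`. By Riesz–Markov–Kakutani the positive functional
`f ↦ ⟨π(f) φ, φ⟩` is a measure `m` of mass `‖φ‖²`, and `‖π(f) φ‖ = ‖f‖` in `L²(m)`. Thus
`f ↦ ⟨π(f) φ, ψ⟩` is bounded by `‖ψ‖` on `L²(m)`, so it is `f ↦ ∫ f conj(k) dm` with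
`‖k‖ ≤ ‖ψ‖` in `L²(m)`, and by Cauchy–Schwarz the measure `conj(k) m` has total variation at most
`‖φ‖ ‖ψ‖`. The last two steps are `exists_complexMeasure_of_L2_bound`, which replaces the Riesz
representation theorem for complex measures.

*From measures to operators* (`exists_unitary_inner_eq_cauchyTransform`). If `ν = g m` with `m`
positive, take multiplication by `conj ζ` on `L²(m)`, `φ = g / |g|^{1/2}` and `ψ = |g|^{1/2}`; then
`‖φ‖ ‖ψ‖ = ∫ |g| dm = ‖ν‖`.

*The infimum is attained* (`exists_totalVariationNorm_eq_cauchyNorm`). For a minimizing sequence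
`μₙ` the functionals given by `μₙ` and by `|μₙ|` have limits `L` and `Λ` along an ultrafilter. `Λ`
is a positive measure `m` whose mass is the infimum, and `|L f| ≤ ∫ |f| dm`, so
`exists_complexMeasure_of_L2_bound` turns `L` into a representing measure of norm at most the mass
of `m`.

Finally `h` is a Cauchy transform if and only if `Bh` is one, since multiplying `μ` by `ζ` or
`conj ζ` changes `Kμ` by a factor `w` or `1 / w`, up to constants, and constants are Cauchy
transforms.
-/

noncomputable section

/-! ### Integration against a complex measure with a density -/

section Density

variable {X : Type*} [MeasurableSpace X] {m : Measure X} {g : X → ℂ}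

theorem integrable_mul_of_integrable_variation (hg : Integrable g m) {f : X → ℂ}
    (hf : (m.withDensityᵥ g).Integrable f) : Integrable (fun x => f x * g x) m := by
  rw [VectorMeasure.Integrable, Measure.variation_withDensityᵥ hg,
    integrable_withDensity_iff_integrable_smul₀' hg.aestronglyMeasurable.enorm
      (by filter_upwards with x using by simp)] at hf
  -- the measurability of `f` is only known where `g ≠ 0`, hence the factor `‖g‖` next to `f`
  have key : (fun x => f x * g x) =
      fun x => (‖g x‖ₑ.toReal • f x) * ((‖g x‖⁻¹ : ℝ) • g x) := by
    funext x
    rcases eq_or_ne (g x) 0 with h | h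
    · simp [h]
    · have : (‖g x‖ : ℂ) ≠ 0 := by simpa using h
      simp only [toReal_enorm, Complex.real_smul, Complex.ofReal_inv]
      field_simp
  rw [key]
  refine hf.mul_bdd (c := 1)
    (hg.aestronglyMeasurable.norm.inv₀.smul hg.aestronglyMeasurable) ?_
  filter_upwards with x
  rw [norm_smul, norm_inv, norm_norm]
  exact inv_mul_le_one

/-- Integration against the complex measure with density `g` is integration of the product
with `g`. -/
theorem integral_withDensityᵥ (hg : Integrable g m) {f : X → ℂ}
    (hf : (m.withDensityᵥ g).Integrable f) :
    (m.withDensityᵥ g).integral f (ContinuousLinearMap.mul ℝ ℂ) = ∫ x, f x * g x ∂m := by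
  have hv := Measure.variation_withDensityᵥ hg
  have hm : AEMeasurable (fun x => ‖g x‖ₑ) m := hg.aestronglyMeasurable.enorm
  revert f
  refine Integrable.induction _ ?_ ?_ ?_ ?_
  · intro c s hs hsf
    have : IsFiniteMeasure ((m.withDensityᵥ g).variation.restrict s) := ⟨by simpa using hsf⟩
    rw [VectorMeasure.integral_indicator_const _ hs, withDensityᵥ_apply hg hs]
    have : (fun x => s.indicator (fun _ => c) x * g x) = s.indicator (fun x => c * g x) := by
      funext x; by_cases hx : x ∈ s <;> simp [hx]
    rw [this, integral_indicator hs, integral_const_mul]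
    rfl
  · intro f₁ f₂ _ h₁ h₂ e₁ e₂
    rw [VectorMeasure.integral_add h₁ h₂, e₁, e₂, ← integral_add
      (integrable_mul_of_integrable_variation hg h₁)
      (integrable_mul_of_integrable_variation hg h₂)]
    simp [add_mul]
  · -- `f ↦ ∫ f g dm` is `1`-Lipschitz on `L¹` of the variation `‖g‖ m`
    refine isClosed_eq VectorMeasure.continuous_integral ?_
    refine (LipschitzWith.of_dist_le_mul (K := 1) fun f₁ f₂ => ?_).continuous
    have i₁ := integrable_mul_of_integrable_variation hg (L1.integrable_coeFn f₁)
    have i₂ := integrable_mul_of_integrable_variation hg (L1.integrable_coeFn f₂)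
    rw [dist_eq_norm, dist_eq_norm, ← integral_sub i₁ i₂, NNReal.coe_one, one_mul,
      L1.norm_eq_integral_norm]
    have e : ∫ x, ‖(f₁ - f₂) x‖ ∂(m.withDensityᵥ g).variation
        = ∫ x, ‖f₁ x - f₂ x‖ ∂(m.withDensityᵥ g).variation := by
      refine integral_congr_ae ?_
      filter_upwards [Lp.coeFn_sub f₁ f₂] with x hx
      rw [hx, Pi.sub_apply]
    have e' (F : X → ℝ) : ∫ x, F x ∂(m.withDensityᵥ g).variation = ∫ x, ‖g x‖ * F x ∂m := by
      rw [hv, integral_withDensity_eq_integral_toReal_smul₀ hm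
        (by filter_upwards with x using by simp)]
      simp
    rw [e, e']
    refine (norm_integral_le_integral_norm _).trans (le_of_eq ?_)
    refine integral_congr_ae (Filter.Eventually.of_forall fun x => ?_)
    change ‖f₁ x * g x - f₂ x * g x‖ = ‖g x‖ * ‖f₁ x - f₂ x‖
    rw [← sub_mul, norm_mul, mul_comm]
  · intro f₁ f₂ h h₁ e
    rw [← VectorMeasure.integral_congr_ae h, e]
    refine integral_congr_ae ?_
    rw [hv, Filter.EventuallyEq, ae_withDensity_iff' hm] at h
    filter_upwards [h] with x hx
    by_cases h0 : g x = 0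
    · simp [h0]
    · rw [hx (by simpa using h0)]

end Density

instance (μ : ComplexMeasure UnitCircle) : IsFiniteMeasure μ.variation :=
  ⟨(variation_univ_ne_top μ).lt_top⟩

theorem totalVariationNorm_withDensityᵥ {m : Measure UnitCircle} {g : UnitCircle → ℂ}
    (hg : Integrable g m) : totalVariationNorm (m.withDensityᵥ g) = ∫ x, ‖g x‖ ∂m := by
  rw [totalVariationNorm, Measure.variation_withDensityᵥ hg, withDensity_apply _ .univ,
    Measure.restrict_univ, integral_norm_eq_lintegral_enorm hg.aestronglyMeasurable]

/-- **Radon–Nikodym** for a complex measure with respect to its variation. -/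
theorem exists_eq_withDensityᵥ (μ : ComplexMeasure UnitCircle) :
    ∃ g : UnitCircle → ℂ, Integrable g μ.variation ∧ μ = μ.variation.withDensityᵥ g := by
  have hac : ∀ s, MeasurableSet s → μ.variation s = 0 → μ s = 0 := fun s _ h => by
    simpa [h] using μ.enorm_measure_le_variation s
  have hre : ComplexMeasure.re μ ≪ᵥ μ.variation.toENNRealVectorMeasure := by
    refine VectorMeasure.AbsolutelyContinuous.mk fun s hs h => ?_
    rw [Measure.toENNRealVectorMeasure_apply_measurable hs] at h
    change (μ s).re = 0
    rw [hac s hs h, Complex.zero_re]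
  have him : ComplexMeasure.im μ ≪ᵥ μ.variation.toENNRealVectorMeasure := by
    refine VectorMeasure.AbsolutelyContinuous.mk fun s hs h => ?_
    rw [Measure.toENNRealVectorMeasure_apply_measurable hs] at h
    change (μ s).im = 0
    rw [hac s hs h, Complex.zero_im]
  refine ⟨ComplexMeasure.rnDeriv μ μ.variation, ComplexMeasure.integrable_rnDeriv _ _, ?_⟩
  have hi := ComplexMeasure.integrable_rnDeriv μ μ.variation
  ext s hs
  rw [withDensityᵥ_apply hi hs]
  apply Complex.ext
  · rw [← RCLike.re_eq_complex_re, ← integral_re hi.integrableOn]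
    have h := congrArg (fun ν : SignedMeasure UnitCircle => ν s)
      (SignedMeasure.withDensityᵥ_rnDeriv_eq _ _ hre)
    simp only [withDensityᵥ_apply (SignedMeasure.integrable_rnDeriv _ _) hs] at h
    exact h.symm
  · rw [← RCLike.im_eq_complex_im, ← integral_im hi.integrableOn]
    have h := congrArg (fun ν : SignedMeasure UnitCircle => ν s)
      (SignedMeasure.withDensityᵥ_rnDeriv_eq _ _ him)
    simp only [withDensityᵥ_apply (SignedMeasure.integrable_rnDeriv _ _) hs] at h
    exact h.symm

theorem integrable_variation (μ : ComplexMeasure UnitCircle) (f : C(UnitCircle, ℂ)) :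
    μ.Integrable f :=
  (map_continuous f).integrable_of_hasCompactSupport (HasCompactSupport.of_compactSpace f)

theorem norm_integral_le_integral_norm_variation (μ : ComplexMeasure UnitCircle)
    (f : UnitCircle → ℂ) :
    ‖μ.integral f (ContinuousLinearMap.mul ℝ ℂ)‖ ≤ ∫ x, ‖f x‖ ∂μ.variation := by
  refine VectorMeasure.norm_integral_le_integral_norm.trans ?_
  refine mul_le_of_le_one_left (integral_nonneg fun _ => norm_nonneg _) ?_
  exact ContinuousLinearMap.opNorm_mul_le ℝ ℂ

/-! ### Functionals on `C(𝕋)` bounded by an `L²` norm -/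

theorem norm_Lp_two_eq_sqrt {X : Type*} [MeasurableSpace X] {m : Measure X} (f : Lp ℂ 2 m) :
    ‖f‖ = Real.sqrt (∫ x, ‖f x‖ ^ 2 ∂m) := by
  rw [@norm_eq_sqrt_re_inner ℂ, L2.inner_def, ← integral_re (L2.integrable_inner f f)]
  congr 2; ext x
  exact inner_self_eq_norm_sq _

theorem integral_norm_le_sqrt_mul_sqrt {X : Type*} [MeasurableSpace X] {m : Measure X}
    [IsFiniteMeasure m] {f : X → ℂ} (hf : MemLp f 2 m) :
    ∫ x, ‖f x‖ ∂m ≤ Real.sqrt (∫ x, ‖f x‖ ^ 2 ∂m) * Real.sqrt (m.real Set.univ) := by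
  have := integral_mul_le_Lp_mul_Lq_of_nonneg (μ := m) (f := fun x => ‖f x‖) (g := fun _ => 1)
    Real.HolderConjugate.two_two (by filter_upwards with x using norm_nonneg _)
    (by filter_upwards with x using zero_le_one)
    (by simpa using hf.norm) (by simpa using memLp_const (1 : ℝ))
  simpa [Real.sqrt_eq_rpow] using this

/-- A linear functional on `C(𝕋)` bounded by `c ‖f‖_{L²(m)}` is integration against a complex
measure of total variation at most `c ‖1‖_{L²(m)}`: by Fréchet–Riesz it is the inner product with
some `k ∈ L²(m)`, so `conj k · m` does it. -/
theorem exists_complexMeasure_of_L2_bound (m : Measure UnitCircle) [IsFiniteMeasure m]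
    (L : C(UnitCircle, ℂ) →ₗ[ℂ] ℂ) {c : ℝ} (hc : 0 ≤ c)
    (hL : ∀ f, ‖L f‖ ≤ c * Real.sqrt (∫ x, ‖f x‖ ^ 2 ∂m)) :
    ∃ ν : ComplexMeasure UnitCircle,
      (∀ f : C(UnitCircle, ℂ), ν.integral f (ContinuousLinearMap.mul ℝ ℂ) = L f) ∧
      totalVariationNorm ν ≤ c * Real.sqrt (m.real Set.univ) := by
  let e : C(UnitCircle, ℂ) →L[ℂ] Lp ℂ 2 m := ContinuousMap.toLp 2 m ℂ
  have hdense : DenseRange e := ContinuousMap.toLp_denseRange (p := 2) ℂ m ℂ (by simp)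
  have hnorme (f : C(UnitCircle, ℂ)) : ‖e f‖ = Real.sqrt (∫ x, ‖f x‖ ^ 2 ∂m) := by
    rw [norm_Lp_two_eq_sqrt]
    congr 1
    refine integral_congr_ae ?_
    filter_upwards [ContinuousMap.coeFn_toLp (p := 2) (𝕜 := ℂ) m f] with x hx
    rw [hx]
  have hbound : ∀ f, ‖L f‖ ≤ c * ‖e.toLinearMap f‖ := fun f => by
    simpa [hnorme] using hL f
  let F : Lp ℂ 2 m →L[ℂ] ℂ := L.extendOfNorm e.toLinearMap
  have hF (f) : F (e f) = L f := LinearMap.extendOfNorm_eq hdense ⟨c, hbound⟩ f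
  have hFn : ‖F‖ ≤ c := ContinuousLinearMap.opNorm_le_bound _ hc
    (LinearMap.norm_extendOfNorm_apply_le hdense c hbound)
  let k : Lp ℂ 2 m := (InnerProductSpace.toDual ℂ _).symm F
  have hk : ‖k‖ ≤ c := by simpa [k] using hFn
  have hki : Integrable (fun x => starRingEnd ℂ (k x)) m := by
    have := (Lp.memLp k).integrable (by norm_num)
    exact (LinearIsometryEquiv.integrable_comp_iff Complex.conjLIE).2 this
  refine ⟨m.withDensityᵥ fun x => starRingEnd ℂ (k x), fun f => ?_, ?_⟩
  · rw [integral_withDensityᵥ hki (integrable_variation _ f), ← hF]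
    have : F (e f) = inner ℂ k (e f) := InnerProductSpace.toDual_symm_apply.symm
    rw [this, L2.inner_def]
    refine integral_congr_ae ?_
    filter_upwards [ContinuousMap.coeFn_toLp (p := 2) (𝕜 := ℂ) m f] with x hx
    rw [hx, RCLike.inner_apply]
  · rw [totalVariationNorm_withDensityᵥ hki]
    simp only [RCLike.norm_conj]
    refine (integral_norm_le_sqrt_mul_sqrt (Lp.memLp k)).trans ?_
    rw [← norm_Lp_two_eq_sqrt]
    gcongr

/-! ### Unitary dilation of a contraction -/

theorem hasSum_norm_sq {H : Type*} [NormedAddCommGroup H] (x : lp (fun _ : ℕ => H) 2) :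
    HasSum (fun n => ‖x n‖ ^ 2) (‖x‖ ^ 2) := by
  simpa using lp.hasSum_norm (p := 2) (by simp) x

section Dilation

variable {H : Type*} [NormedAddCommGroup H] [InnerProductSpace ℂ H]

/-- Resolvents intertwine along with the operators. -/
theorem map_inverse_one_sub_smul {K : Type*} [NormedAddCommGroup K] [InnerProductSpace ℂ K]
    {A : H →L[ℂ] H} {B : K →L[ℂ] K} (T : K →L[ℂ] H) (hT : ∀ x, T (B x) = A (T x)) {w : ℂ}
    (hA : IsUnit (1 - w • A)) (hB : IsUnit (1 - w • B)) (x : K) :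
    T (Ring.inverse (1 - w • B) x) = Ring.inverse (1 - w • A) (T x) := by
  set y := Ring.inverse (1 - w • B) x with hy
  have hx : x = (1 - w • B) y := by
    rw [hy, ← mul_apply_eq_comp, Ring.mul_inverse_cancel _ hB,
      one_apply_eq_self]
  have h2 : T x = (1 - w • A) (T y) := by
    rw [hx]; simp [hT]
  rw [h2, ← mul_apply_eq_comp, Ring.inverse_mul_cancel _ hA,
    one_apply_eq_self]

/-- The witness is the defect operator `(1 - A* A)^{1/2}`. -/
theorem exists_defect [CompleteSpace H] {A : H →L[ℂ] H} (hA : ‖A‖ ≤ 1) :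
    ∃ D : H →L[ℂ] H, ∀ x, ‖A x‖ ^ 2 + ‖D x‖ ^ 2 = ‖x‖ ^ 2 := by
  have hpos : (0 : H →L[ℂ] H) ≤ 1 - star A * A := by
    rw [sub_nonneg]
    refine (CStarAlgebra.star_mul_le_algebraMap_norm_sq (A := H →L[ℂ] H)).trans ?_
    rw [← map_one (algebraMap ℝ (H →L[ℂ] H))]
    exact algebraMap_mono _ (pow_le_one₀ (norm_nonneg _) hA)
  refine ⟨CFC.sqrt (1 - star A * A), fun x => ?_⟩
  set D := CFC.sqrt (1 - star A * A) with hD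
  have hsq : D * D = 1 - star A * A := CFC.sqrt_mul_sqrt_self _ hpos
  have hsa : ContinuousLinearMap.adjoint D = D := by
    rw [← ContinuousLinearMap.star_eq_adjoint]
    exact (IsSelfAdjoint.of_nonneg (CFC.sqrt_nonneg _)).star_eq
  have h1 : (inner ℂ (D x) (D x) : ℂ) = inner ℂ x x - inner ℂ (A x) (A x) := by
    conv_lhs => rw [← ContinuousLinearMap.adjoint_inner_right, hsa]
    rw [← mul_apply_eq_comp, hsq, ContinuousLinearMap.star_eq_adjoint]
    simp [inner_sub_right, ContinuousLinearMap.adjoint_inner_right]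
  simp only [inner_self_eq_norm_sq_to_K] at h1
  have h2 : ‖D x‖ ^ 2 = ‖x‖ ^ 2 - ‖A x‖ ^ 2 := by exact_mod_cast h1
  rw [h2]; ring

/-- The sequence `(A x₀, D x₀, x₁, x₂, …)`. -/
def dilationSeq (A D : H →L[ℂ] H) (x : ℕ → H) : ℕ → H
  | 0 => A (x 0)
  | 1 => D (x 0)
  | n + 2 => x (n + 1)

theorem hasSum_norm_sq_dilationSeq {A D : H →L[ℂ] H}
    (h : ∀ x, ‖A x‖ ^ 2 + ‖D x‖ ^ 2 = ‖x‖ ^ 2) (x : lp (fun _ : ℕ => H) 2) :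
    HasSum (fun n => ‖dilationSeq A D x n‖ ^ 2) (‖x‖ ^ 2) := by
  rw [← hasSum_nat_add_iff' 2]
  have := (hasSum_nat_add_iff' 1).2 (hasSum_norm_sq x)
  have e : ∑ i ∈ Finset.range 2, ‖dilationSeq A D x i‖ ^ 2 = ∑ i ∈ Finset.range 1, ‖x i‖ ^ 2 := by
    rw [Finset.sum_range_succ, Finset.sum_range_one, Finset.sum_range_one]
    exact h (x 0)
  rw [e]
  exact this

/-- The isometric dilation `(x₀, x₁, …) ↦ (A x₀, D x₀, x₁, …)` of a contraction `A` with defect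
operator `D`. -/
def isometricDilation (A D : H →L[ℂ] H) (h : ∀ x, ‖A x‖ ^ 2 + ‖D x‖ ^ 2 = ‖x‖ ^ 2) :
    lp (fun _ : ℕ => H) 2 →ₗᵢ[ℂ] lp (fun _ : ℕ => H) 2 where
  toFun x := ⟨dilationSeq A D x, memℓp_gen
    (by simpa using (hasSum_norm_sq_dilationSeq h x).summable)⟩
  map_add' x y := by
    ext n
    match n with
    | 0 => exact map_add A _ _
    | 1 => exact map_add D _ _
    | n + 2 => rfl
  map_smul' c x := by
    ext n
    match n with
    | 0 => exact map_smul A _ _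
    | 1 => exact map_smul D _ _
    | n + 2 => rfl
  norm_map' x := by
    rw [← sq_eq_sq₀ (norm_nonneg _) (norm_nonneg _)]
    exact (hasSum_norm_sq _).unique (hasSum_norm_sq_dilationSeq h x)

section Halmos

variable [CompleteSpace H]

/-- The unitary matrix `[[V, 1 - V V*], [0, V*]]` on `H ⊕ H` extending an isometry `V`. -/
def unitaryExtension (V : H →L[ℂ] H) : WithLp 2 (H × H) →L[ℂ] WithLp 2 (H × H) :=
  let e := WithLp.prodContinuousLinearEquiv 2 ℂ H H
  e.symm.toContinuousLinearMap ∘L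
    ((V ∘L .fst ℂ H H + (1 - V * star V) ∘L .snd ℂ H H).prod (star V ∘L .snd ℂ H H)) ∘L
      e.toContinuousLinearMap

theorem unitaryExtension_apply (V : H →L[ℂ] H) (x : WithLp 2 (H × H)) :
    unitaryExtension V x =
      WithLp.toLp 2 (V x.fst + (x.snd - V (star V x.snd)), star V x.snd) := rfl

theorem unitaryExtension_mem_unitary {V : H →L[ℂ] H} (hV : star V * V = 1) :
    unitaryExtension V ∈ unitary (WithLp 2 (H × H) →L[ℂ] WithLp 2 (H × H)) := by
  let e := WithLp.prodContinuousLinearEquiv 2 ℂ H H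
  let W' : WithLp 2 (H × H) →L[ℂ] WithLp 2 (H × H) := e.symm.toContinuousLinearMap ∘L
    ((star V ∘L .fst ℂ H H).prod ((1 - V * star V) ∘L .fst ℂ H H + V ∘L .snd ℂ H H)) ∘L
      e.toContinuousLinearMap
  have hW' (x) : W' x =
    WithLp.toLp 2 (star V x.fst, (x.fst - V (star V x.fst)) + V x.snd) := rfl
  have hVV (x) : star V (V x) = x := by
    rw [← mul_apply_eq_comp, hV, one_apply_eq_self]
  have hstar : star (unitaryExtension V) = W' := by
    rw [ContinuousLinearMap.star_eq_adjoint, eq_comm, ContinuousLinearMap.eq_adjoint_iff]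
    intro x y
    simp only [hW', unitaryExtension_apply, WithLp.prod_inner_apply, inner_add_left,
      inner_add_right, inner_sub_left, inner_sub_right, ContinuousLinearMap.star_eq_adjoint,
      ContinuousLinearMap.adjoint_inner_left, ContinuousLinearMap.adjoint_inner_right]
    have hVx : inner ℂ (V (ContinuousLinearMap.adjoint V x.fst)) y.snd =
        inner ℂ x.fst (V (ContinuousLinearMap.adjoint V y.snd)) := by
      rw [← ContinuousLinearMap.adjoint_inner_right, ContinuousLinearMap.adjoint_inner_left]
    change inner ℂ x.fst (V y.fst) + (inner ℂ x.fst y.snd -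
      inner ℂ (V (ContinuousLinearMap.adjoint V x.fst)) y.snd + inner ℂ (V x.snd) y.snd) = _
    rw [hVx, ← add_assoc]
    rfl
  rw [Unitary.mem_iff, hstar]
  constructor
  · refine ContinuousLinearMap.ext fun x => ?_
    simp [hW', unitaryExtension_apply, hVV]
    rfl
  · refine ContinuousLinearMap.ext fun x => ?_
    simp [hW', unitaryExtension_apply, hVV]
    rfl

end Halmos

theorem norm_le_one_of_mem_unitary [CompleteSpace H] {U : H →L[ℂ] H}
    (hU : U ∈ unitary (H →L[ℂ] H)) : ‖U‖ ≤ 1 :=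
  U.opNorm_le_bound zero_le_one fun x => by
    rw [one_mul, ContinuousLinearMap.norm_map_of_mem_unitary hU]

end Dilation

/-- **Sz.-Nagy dilation**, in resolvent form: the isometric dilation of `A` is extended to a
unitary operator, and resolvents are intertwined both by the evaluation `x ↦ x₀` and by the
inclusion of the first summand. -/
theorem exists_unitary_dilation {H : Type u} [NormedAddCommGroup H] [InnerProductSpace ℂ H]
    [CompleteSpace H] {A : H →L[ℂ] H} (hA : ‖A‖ ≤ 1) :
    ∃ (K : Type u) (_ : NormedAddCommGroup K) (_ : InnerProductSpace ℂ K) (_ : CompleteSpace K)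
      (U : K →L[ℂ] K) (J : H → K), U ∈ unitary (K →L[ℂ] K) ∧ (∀ x, ‖J x‖ = ‖x‖) ∧
      ∀ w ∈ unitDisk, ∀ x y, inner ℂ (J y) (Ring.inverse (1 - w • U) (J x)) =
        inner ℂ y (Ring.inverse (1 - w • A) x) := by
  obtain ⟨D, hD⟩ := exists_defect hA
  let V := (isometricDilation A D hD).toContinuousLinearMap
  have hV : star V * V = 1 := by
    rw [ContinuousLinearMap.star_eq_adjoint]
    exact (ContinuousLinearMap.norm_map_iff_adjoint_comp_self V).1
      (isometricDilation A D hD).norm_map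
  have hV1 : ‖V‖ ≤ 1 := (isometricDilation A D hD).norm_toContinuousLinearMap_le
  let p : lp (fun _ : ℕ => H) 2 →L[ℂ] H := lp.evalCLM ℂ (fun _ : ℕ => H) 2 0
  let i : lp (fun _ : ℕ => H) 2 →L[ℂ] WithLp 2 (_ × _) :=
    (WithLp.prodContinuousLinearEquiv 2 ℂ _ _).symm.toContinuousLinearMap ∘L
      .inl ℂ _ (lp (fun _ : ℕ => H) 2)
  have hi (x) : i x = WithLp.toLp 2 (x, 0) := rfl
  have hU := unitaryExtension_mem_unitary hV
  refine ⟨_, _, _, inferInstance, unitaryExtension V, fun x => i (lp.single 2 0 x), hU,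
    fun x => ?_, fun w hw x y => ?_⟩
  · simp [hi, lp.norm_single]
  · rw [← map_inverse_one_sub_smul i (A := unitaryExtension V) (B := V) (fun z => ?_)
      (isUnit_one_sub_smul (norm_le_one_of_mem_unitary hU) hw) (isUnit_one_sub_smul hV1 hw)]
    · simp only [hi, WithLp.prod_inner_apply, inner_zero_left, add_zero, lp.inner_single_left]
      have := map_inverse_one_sub_smul p (A := A) (B := V) (fun z => rfl)
        (isUnit_one_sub_smul hA hw) (isUnit_one_sub_smul hV1 hw) (lp.single 2 0 x)
      change _ = Ring.inverse (1 - w • A) (lp.single (E := fun _ : ℕ => H) 2 0 x 0) at this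
      rw [lp.single_apply_self] at this
      rw [← this]
      rfl
    · simp [hi, unitaryExtension_apply]

/-! ### Complex measures attached to operators -/

/-- Riesz–Markov–Kakutani on the circle. -/
theorem exists_measure_of_positive (Λ : C(UnitCircle, ℝ) →ₗ[ℝ] ℝ)
    (hΛ : ∀ f : C(UnitCircle, ℝ), 0 ≤ f → 0 ≤ Λ f) :
    ∃ m : Measure UnitCircle, IsFiniteMeasure m ∧ ∀ f : C(UnitCircle, ℝ), ∫ x, f x ∂m = Λ f := by
  let Λ' : CompactlySupportedContinuousMap UnitCircle ℝ →ₚ[ℝ] ℝ := PositiveLinearMap.mk₀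
    { toFun := fun f => Λ f.toContinuousMap
      map_add' := fun f g => Λ.map_add f.toContinuousMap g.toContinuousMap
      map_smul' := fun c f => Λ.map_smul c f.toContinuousMap }
    (fun f hf => hΛ f.toContinuousMap fun x => hf x)
  exact ⟨RealRMK.rieszMeasure Λ', inferInstance, fun f =>
    RealRMK.integral_rieszMeasure Λ' (CompactlySupportedContinuousMap.continuousMapEquiv f)⟩

/-- The function `ζ ↦ conj ζ` on the circle. -/
def conjCoord : C(UnitCircle, ℂ) :=
  ⟨fun ζ => starRingEnd ℂ (ζ : ℂ), Complex.continuous_conj.comp continuous_subtype_val⟩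

theorem one_sub_mul_conj_ne_zero {w : ℂ} (hw : w ∈ unitDisk) (ζ : UnitCircle) :
    1 - w * starRingEnd ℂ (ζ : ℂ) ≠ 0 := by
  intro h
  have h1 : ‖w * starRingEnd ℂ (ζ : ℂ)‖ = 1 := by rw [← sub_eq_zero.1 h, norm_one]
  have h2 : ‖(ζ : ℂ)‖ = 1 := by simp
  rw [norm_mul, RCLike.norm_conj, h2, mul_one] at h1
  simp [h1] at hw

/-- The Cauchy kernel `ζ ↦ 1 / (1 - w conj ζ)`, for `w` in the disk. -/
def cauchyKernel (w : ℂ) (hw : w ∈ unitDisk) : C(UnitCircle, ℂ) :=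
  ⟨fun ζ => 1 / (1 - w * starRingEnd ℂ (ζ : ℂ)), continuous_const.div
    (continuous_const.sub (continuous_const.mul conjCoord.continuous))
    (one_sub_mul_conj_ne_zero hw)⟩

theorem cauchyKernel_mul {w : ℂ} (hw : w ∈ unitDisk) :
    cauchyKernel w hw * (1 - w • conjCoord) = 1 := by
  ext ζ
  exact one_div_mul_cancel (one_sub_mul_conj_ne_zero hw ζ)

theorem cauchyTransform_eq_integral (μ : ComplexMeasure UnitCircle) {w : ℂ} (hw : w ∈ unitDisk) :
    cauchyTransform μ w = μ.integral (cauchyKernel w hw) (ContinuousLinearMap.mul ℝ ℂ) := rfl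

section Spectral

variable {H : Type*} [NormedAddCommGroup H] [InnerProductSpace ℂ H] [CompleteSpace H]

/-- The continuous functional calculus of a unitary operator `U`, as a representation of `C(𝕋)`
that sends `conj ζ` to `U`. -/
theorem exists_starAlgHom {U : H →L[ℂ] H} (hU : U ∈ unitary (H →L[ℂ] H)) :
    ∃ π : C(UnitCircle, ℂ) →⋆ₐ[ℂ] (H →L[ℂ] H), π conjCoord = U := by
  -- `conj ζ ↦ U` means `ζ ↦ star U`, so this is the functional calculus of `star U`
  have hU' : star U ∈ unitary (H →L[ℂ] H) := Unitary.star_mem hU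
  have hn : IsStarNormal (star U) :=
    (unitary_iff_isStarNormal_and_spectrum_subset_unitary.1 hU').1
  have hs : ∀ z : spectrum ℂ (star U), (z : ℂ) ∈ Metric.sphere (0 : ℂ) 1 := fun z => by
    have := CStarRing.norm_of_mem_unitary (spectrum_subset_unitary_of_mem_unitary hU' z.2)
    simpa using this
  let ι : C(spectrum ℂ (star U), UnitCircle) :=
    ⟨fun z => ⟨z, hs z⟩, continuous_subtype_val.subtype_mk _⟩
  refine ⟨(cfcHom hn).comp (ContinuousMap.compStarAlgHom' ℂ ℂ ι), ?_⟩
  have : ContinuousMap.compStarAlgHom' ℂ ℂ ι conjCoord =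
      star ((ContinuousMap.id ℂ).restrict (spectrum ℂ (star U))) := rfl
  rw [StarAlgHom.comp_apply, this, map_star, cfcHom_id, star_star]

/-- The matrix entries `⟨π(f) φ, ψ⟩` of a representation of `C(𝕋)` are given by a complex measure
of total variation at most `‖φ‖ ‖ψ‖`. -/
theorem exists_complexMeasure_of_starAlgHom (π : C(UnitCircle, ℂ) →⋆ₐ[ℂ] (H →L[ℂ] H)) (φ ψ : H) :
    ∃ ν : ComplexMeasure UnitCircle,
      (∀ f : C(UnitCircle, ℂ), ν.integral f (ContinuousLinearMap.mul ℝ ℂ) = inner ℂ ψ (π f φ)) ∧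
      totalVariationNorm ν ≤ ‖φ‖ * ‖ψ‖ := by
  let ofR : C(UnitCircle, ℝ) → C(UnitCircle, ℂ) := fun f =>
    ⟨fun x => (f x : ℂ), Complex.continuous_ofReal.comp f.continuous⟩
  have hsq (f : C(UnitCircle, ℂ)) : (inner ℂ φ (π (star f * f) φ)).re = ‖π f φ‖ ^ 2 := by
    rw [map_mul, map_star, mul_apply_eq_comp, ContinuousLinearMap.star_eq_adjoint,
      ContinuousLinearMap.adjoint_inner_right]
    exact inner_self_eq_norm_sq (𝕜 := ℂ) _
  let Λ : C(UnitCircle, ℝ) →ₗ[ℝ] ℝ :=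
    { toFun := fun f => (inner ℂ φ (π (ofR f) φ)).re
      map_add' := fun f g => by
        have : ofR (f + g) = ofR f + ofR g := by ext x; simp [ofR]
        rw [this, map_add, add_apply, inner_add_right, Complex.add_re]
      map_smul' := fun c f => by
        have : ofR (c • f) = (c : ℂ) • ofR f := by ext x; simp [ofR]
        rw [this, map_smul, smul_apply, inner_smul_right, Complex.re_ofReal_mul]
        rfl }
  obtain ⟨m, hm, hmΛ⟩ := exists_measure_of_positive Λ fun f hf => by
    let g : C(UnitCircle, ℝ) := ⟨fun x => Real.sqrt (f x), f.continuous.sqrt⟩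
    have : ofR f = star (ofR g) * ofR g := by
      ext x
      change (f x : ℂ) = starRingEnd ℂ (Real.sqrt (f x) : ℂ) * (Real.sqrt (f x) : ℂ)
      have hfx : 0 ≤ f x := hf x
      rw [Complex.conj_ofReal, ← Complex.ofReal_mul, Real.mul_self_sqrt hfx]
    change 0 ≤ (inner ℂ φ (π (ofR f) φ)).re
    rw [this, hsq]
    positivity
  -- `f ↦ π(f) φ` is isometric for the norm of `L²(m)`
  have hint (f : C(UnitCircle, ℂ)) : ∫ x, ‖f x‖ ^ 2 ∂m = ‖π f φ‖ ^ 2 := by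
    have h := hmΛ ⟨fun x => ‖f x‖ ^ 2, f.continuous.norm.pow 2⟩
    rw [← hsq f]
    refine h.trans ?_
    change (inner ℂ φ (π (ofR _) φ)).re = _
    congr 4
    ext x
    change ((‖f x‖ ^ 2 : ℝ) : ℂ) = starRingEnd ℂ (f x) * f x
    rw [RCLike.conj_mul]
    norm_cast
  have huniv : m.real Set.univ = ‖φ‖ ^ 2 := by
    have := hint 1
    rw [map_one] at this
    simpa using this
  obtain ⟨ν, h1, h2⟩ := exists_complexMeasure_of_L2_bound m
    ((innerSL ℂ ψ).toLinearMap ∘ₗ (ContinuousLinearMap.apply ℂ H φ).toLinearMap ∘ₗ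
      π.toAlgHom.toLinearMap) (norm_nonneg ψ) (fun f => by
        rw [hint, Real.sqrt_sq (norm_nonneg _)]
        exact norm_inner_le_norm ψ (π f φ))
  refine ⟨ν, h1, h2.trans (le_of_eq ?_)⟩
  rw [huniv, Real.sqrt_sq (norm_nonneg _), mul_comm]

/-- The resolvent matrix entries of a contraction are Cauchy transforms, with the bound
`‖φ‖ ‖ψ‖` on the norm. -/
theorem exists_cauchyTransform_eq_inner {A : H →L[ℂ] H} (hA : ‖A‖ ≤ 1) (φ ψ : H) :
    ∃ ν : ComplexMeasure UnitCircle,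
      (∀ w ∈ unitDisk, inner ℂ ψ (Ring.inverse (1 - w • A) φ) = cauchyTransform ν w) ∧
      totalVariationNorm ν ≤ ‖φ‖ * ‖ψ‖ := by
  obtain ⟨K, _, _, _, U, J, hU, hJ, hres⟩ := exists_unitary_dilation hA
  obtain ⟨π, hπ⟩ := exists_starAlgHom hU
  obtain ⟨ν, hν, hn⟩ := exists_complexMeasure_of_starAlgHom π (J φ) (J ψ)
  refine ⟨ν, fun w hw => ?_, by simpa [hJ] using hn⟩
  rw [cauchyTransform_eq_integral ν hw, hν, ← hres w hw]
  have h1 : π (cauchyKernel w hw) * (1 - w • U) = 1 := by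
    rw [← hπ, ← map_smul, ← map_one π, ← map_sub, ← map_mul, cauchyKernel_mul]
  have h2 := isUnit_one_sub_smul (norm_le_one_of_mem_unitary hU) hw
  have h3 : Ring.inverse (1 - w • U) = π (cauchyKernel w hw) :=
    (left_inv_eq_right_inv h1 (Ring.mul_inverse_cancel _ h2)).symm
  rw [h3]

end Spectral

/-! ### A representing measure of least total variation -/

/-- Integration of continuous functions against a complex measure, as a linear functional. -/
def integralFunctional (μ : ComplexMeasure UnitCircle) : C(UnitCircle, ℂ) →ₗ[ℂ] ℂ where
  toFun f := μ.integral f (ContinuousLinearMap.mul ℝ ℂ)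
  map_add' f g := VectorMeasure.integral_add (integrable_variation μ f) (integrable_variation μ g)
  map_smul' c f := by
    -- the vector measure integral is only known to be `ℝ`-linear, so pass to a density
    obtain ⟨g, hg, h⟩ := exists_eq_withDensityᵥ μ
    have key (f : C(UnitCircle, ℂ)) :
        μ.integral f (ContinuousLinearMap.mul ℝ ℂ) = ∫ x, f x * g x ∂μ.variation := by
      have := integrable_variation μ f
      rw [h] at this
      conv_lhs => rw [h]
      exact integral_withDensityᵥ hg this
    rw [key, key]
    simp [mul_assoc, integral_const_mul]

/-- Pointwise limits of bounded sequences of functionals along an ultrafilter exist and are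
linear. -/
theorem exists_linearMap_tendsto {𝕜 E : Type*} [RCLike 𝕜] [AddCommGroup E] [Module 𝕜 E]
    (𝓤 : Ultrafilter ℕ) (L : ℕ → E →ₗ[𝕜] 𝕜) (B : E → ℝ) (hB : ∀ n f, ‖L n f‖ ≤ B f) :
    ∃ L' : E →ₗ[𝕜] 𝕜, ∀ f, Filter.Tendsto (fun n => L n f) 𝓤 (nhds (L' f)) := by
  have h (f : E) : ∃ z : 𝕜, Filter.Tendsto (fun n => L n f) 𝓤 (nhds z) := by
    obtain ⟨z, -, hz⟩ := (isCompact_closedBall (0 : 𝕜) (B f)).ultrafilter_le_nhds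
      (𝓤.map fun n => L n f) (by
        rw [Filter.le_principal_iff]
        exact Filter.mem_map.2 (Filter.Eventually.of_forall fun n => by simpa using hB n f))
    exact ⟨z, hz⟩
  choose l hl using h
  refine ⟨{ toFun := l, map_add' := fun f g => ?_, map_smul' := fun c f => ?_ }, hl⟩
  · refine tendsto_nhds_unique (hl (f + g)) ?_
    simpa using (hl f).add (hl g)
  · refine tendsto_nhds_unique (hl (c • f)) ?_
    simpa using (hl f).const_mul c

/-- The infimum in the norm of a Cauchy transform is attained. -/
theorem exists_totalVariationNorm_eq_cauchyNorm {h : ℂ → ℂ}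
    (hne : (representingMeasures h).Nonempty) :
    ∃ μ ∈ representingMeasures h, totalVariationNorm μ = cauchyNorm h := by
  have hbdd : BddBelow (totalVariationNorm '' representingMeasures h) :=
    ⟨0, by rintro _ ⟨μ, -, rfl⟩; exact ENNReal.toReal_nonneg⟩
  obtain ⟨u, -, hu, hmem⟩ := exists_seq_tendsto_sInf (hne.image totalVariationNorm) hbdd
  choose μ hμ hμu using hmem
  obtain ⟨C, hC⟩ := hu.bddAbove_range
  have hC' (n) : (μ n).variation.real Set.univ ≤ C := by
    have : totalVariationNorm (μ n) = (μ n).variation.real Set.univ := rfl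
    rw [← this, hμu]
    exact hC ⟨n, rfl⟩
  have hint (f : C(UnitCircle, ℝ)) (n) : Integrable f (μ n).variation :=
    f.continuous.integrable_of_hasCompactSupport (HasCompactSupport.of_compactSpace f)
  have hnorm (f : C(UnitCircle, ℂ)) (n) : ∫ x, ‖f x‖ ∂(μ n).variation ≤ ‖f‖ * C := by
    refine (integral_mono (integrable_variation (μ n) f).norm (integrable_const ‖f‖)
      f.norm_coe_le_norm).trans ?_
    rw [integral_const, smul_eq_mul, mul_comm]
    gcongr
    exact hC' n
  let 𝓤 : Ultrafilter ℕ := Filter.hyperfilter ℕ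
  -- `L` is the limit of the functionals `μₙ`, and `Λ` that of their variations
  obtain ⟨L, hL⟩ := exists_linearMap_tendsto 𝓤 (fun n => integralFunctional (μ n))
    (fun f => ‖f‖ * C) fun n f =>
      (norm_integral_le_integral_norm_variation (μ n) f).trans (hnorm f n)
  obtain ⟨Λ, hΛ⟩ := exists_linearMap_tendsto 𝓤
    (fun n => ({ toFun := fun f => ∫ x, f x ∂(μ n).variation
                 map_add' := fun f g => integral_add (hint f n) (hint g n)
                 map_smul' := fun c f => integral_const_mul c f } : C(UnitCircle, ℝ) →ₗ[ℝ] ℝ))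
    (fun f => ‖f‖ * C) fun n f => by
      refine (norm_integral_le_integral_norm _).trans ?_
      refine (integral_mono (hint f n).norm (integrable_const ‖f‖) f.norm_coe_le_norm).trans ?_
      rw [integral_const, smul_eq_mul, mul_comm]
      gcongr
      exact hC' n
  simp only [LinearMap.coe_mk, AddHom.coe_mk] at hΛ
  obtain ⟨m, hm, hmΛ⟩ := exists_measure_of_positive Λ fun f hf =>
    ge_of_tendsto' (hΛ f) fun n => integral_nonneg hf
  have huniv : m.real Set.univ = cauchyNorm h := by
    have h1 : m.real Set.univ = Λ 1 := by simpa using hmΛ 1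
    rw [h1]
    refine tendsto_nhds_unique (hΛ 1) ?_
    have h2 := hu.mono_left (Nat.hyperfilter_le_atTop)
    refine h2.congr fun n => ?_
    rw [← hμu]
    simp [totalVariationNorm, Measure.real]
  have hbound (f : C(UnitCircle, ℂ)) :
      ‖L f‖ ≤ Real.sqrt (m.real Set.univ) * Real.sqrt (∫ x, ‖f x‖ ^ 2 ∂m) := by
    let fn : C(UnitCircle, ℝ) := ⟨fun x => ‖f x‖, f.continuous.norm⟩
    have h1 : ‖L f‖ ≤ ∫ x, ‖f x‖ ∂m := by
      rw [show ∫ x, ‖f x‖ ∂m = Λ fn from hmΛ fn]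
      exact le_of_tendsto_of_tendsto' (hL f).norm (hΛ fn) fun n =>
        norm_integral_le_integral_norm_variation (μ n) f
    refine h1.trans ?_
    rw [mul_comm]
    exact integral_norm_le_sqrt_mul_sqrt (f.memLp _ ℂ)
  obtain ⟨ν, hν, hνn⟩ := exists_complexMeasure_of_L2_bound m L (Real.sqrt_nonneg _) hbound
  rw [Real.mul_self_sqrt measureReal_nonneg, huniv] at hνn
  have hνmem : ν ∈ representingMeasures h := fun w hw => by
    rw [cauchyTransform_eq_integral ν hw, hν]
    refine tendsto_nhds_unique ?_ (hL (cauchyKernel w hw))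
    refine tendsto_const_nhds.congr fun n => ?_
    exact hμ n w hw
  exact ⟨ν, hνmem, hνn.antisymm (csInf_le hbdd ⟨ν, hνmem, rfl⟩)⟩

/-! ### Multiplication operators on `L²` -/

section Multiplication
open scoped ENNReal
variable {α : Type*} [MeasurableSpace α] {m : Measure α}

/-- Multiplication by a bounded function on `L²(m)`. -/
def mulL2 {a : α → ℂ} (ha : MemLp a ∞ m) : Lp ℂ 2 m →L[ℂ] Lp ℂ 2 m :=
  (ContinuousLinearMap.mul ℂ ℂ).holderL m ∞ 2 2 ha.toLp

theorem coeFn_mulL2 {a : α → ℂ} (ha : MemLp a ∞ m) (f : Lp ℂ 2 m) :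
    mulL2 ha f =ᵐ[m] fun x => a x * f x := by
  have h1 := (ContinuousLinearMap.mul ℂ ℂ).coeFn_holder (r := 2) ha.toLp f
  filter_upwards [h1, ha.coeFn_toLp] with x hx hx'
  rw [← hx']
  exact hx

theorem mulL2_mem_unitary {a : α → ℂ} (ha : MemLp a ∞ m) (ha1 : ∀ x, ‖a x‖ = 1) :
    mulL2 ha ∈ unitary (Lp ℂ 2 m →L[ℂ] Lp ℂ 2 m) := by
  have hb : MemLp (fun x => starRingEnd ℂ (a x)) ∞ m := ha.star
  have hab (x) : starRingEnd ℂ (a x) * a x = 1 := by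
    rw [RCLike.conj_mul, ha1]; simp
  have hstar : star (mulL2 ha) = mulL2 hb := by
    rw [ContinuousLinearMap.star_eq_adjoint, eq_comm, ContinuousLinearMap.eq_adjoint_iff]
    intro f g
    rw [L2.inner_def, L2.inner_def]
    refine integral_congr_ae ?_
    filter_upwards [coeFn_mulL2 hb f, coeFn_mulL2 ha g] with x hx hx'
    rw [hx, hx']
    simp only [RCLike.inner_apply, map_mul, RCLike.conj_conj]
    ring
  rw [Unitary.mem_iff, hstar]
  constructor
  · refine ContinuousLinearMap.ext fun f => Lp.ext ?_
    rw [mul_apply_eq_comp, one_apply_eq_self]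
    filter_upwards [coeFn_mulL2 hb (mulL2 ha f), coeFn_mulL2 ha f] with x hx hx'
    rw [hx, hx', ← mul_assoc, hab, one_mul]
  · refine ContinuousLinearMap.ext fun f => Lp.ext ?_
    rw [mul_apply_eq_comp, one_apply_eq_self]
    filter_upwards [coeFn_mulL2 ha (mulL2 hb f), coeFn_mulL2 hb f] with x hx hx'
    rw [hx, hx', ← mul_assoc, mul_comm (a x), hab, one_mul]

/-- The resolvent of a multiplication operator is multiplication by `1 / (1 - w a)`. -/
theorem inverse_one_sub_smul_mulL2 {a : α → ℂ} (ha : MemLp a ∞ m) (ha1 : ∀ x, ‖a x‖ = 1)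
    {w : ℂ} (hw : w ∈ unitDisk) (f : Lp ℂ 2 m) :
    Ring.inverse (1 - w • mulL2 ha) f =ᵐ[m] fun x => f x / (1 - w * a x) := by
  have hunit := isUnit_one_sub_smul (norm_le_one_of_mem_unitary (mulL2_mem_unitary ha ha1)) hw
  set y := Ring.inverse (1 - w • mulL2 ha) f with hy
  have hf : f = y - w • mulL2 ha y := by
    have : f = (1 - w • mulL2 ha) y := by
      rw [hy, ← mul_apply_eq_comp, Ring.mul_inverse_cancel _ hunit, one_apply_eq_self]
    rw [this]; rfl
  have h1 : f =ᵐ[m] fun x => (1 - w * a x) * y x := by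
    rw [hf]
    filter_upwards [Lp.coeFn_sub y (w • mulL2 ha y), Lp.coeFn_smul w (mulL2 ha y),
      coeFn_mulL2 ha y] with x hx hx' hx''
    rw [hx, Pi.sub_apply, hx', Pi.smul_apply, hx'', smul_eq_mul]
    ring
  filter_upwards [h1] with x hx
  have hne : 1 - w * a x ≠ 0 := fun h => by
    have : ‖w * a x‖ = 1 := by rw [← sub_eq_zero.1 h, norm_one]
    rw [norm_mul, ha1, mul_one] at this
    simp [this] at hw
  rw [hx, mul_div_cancel_left₀ _ hne]

/-- Splitting `g = (g / |g|^{1/2}) · |g|^{1/2}` exhibits `∫ g / (1 - w a)` as a resolvent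
matrix entry of multiplication by `a`. -/
theorem exists_inner_inverse_mulL2 {a g : α → ℂ} (ha : MemLp a ∞ m) (ha1 : ∀ x, ‖a x‖ = 1)
    (hg : Integrable g m) :
    ∃ φ ψ : Lp ℂ 2 m, ‖φ‖ * ‖ψ‖ = ∫ x, ‖g x‖ ∂m ∧ ∀ w ∈ unitDisk,
      inner ℂ ψ (Ring.inverse (1 - w • mulL2 ha) φ) = ∫ x, 1 / (1 - w * a x) * g x ∂m := by
  let s : α → ℂ := fun x => (Real.sqrt ‖g x‖ : ℂ)
  have hs_meas : AEStronglyMeasurable s m :=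
    (Complex.continuous_ofReal.comp Real.continuous_sqrt).comp_aestronglyMeasurable
      hg.aestronglyMeasurable.norm
  let t : α → ℂ := fun x => g x / s x
  have ht_meas : AEStronglyMeasurable t m :=
    (hg.aestronglyMeasurable.aemeasurable.div hs_meas.aemeasurable).aestronglyMeasurable
  have hs_norm (x) : ‖s x‖ ^ 2 = ‖g x‖ := by
    simp only [s, Complex.norm_real, Real.norm_eq_abs, sq_abs, Real.sq_sqrt (norm_nonneg _)]
  have ht_norm (x) : ‖t x‖ ^ 2 = ‖g x‖ := by
    rw [norm_div, div_pow, hs_norm, sq, mul_self_div_self]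
  have hs : MemLp s 2 m := (memLp_two_iff_integrable_sq_norm hs_meas).2
    (by simpa [hs_norm] using hg.norm)
  have ht : MemLp t 2 m := (memLp_two_iff_integrable_sq_norm ht_meas).2
    (by simpa [ht_norm] using hg.norm)
  have hn {r : α → ℂ} (hr : MemLp r 2 m) (h : ∀ x, ‖r x‖ ^ 2 = ‖g x‖) :
      ‖hr.toLp‖ = Real.sqrt (∫ x, ‖g x‖ ∂m) := by
    rw [norm_Lp_two_eq_sqrt]
    congr 1
    refine integral_congr_ae ?_
    filter_upwards [hr.coeFn_toLp] with x hx
    rw [hx, h]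
  refine ⟨ht.toLp, hs.toLp, ?_, fun w hw => ?_⟩
  · rw [hn ht ht_norm, hn hs hs_norm, Real.mul_self_sqrt (integral_nonneg fun _ => norm_nonneg _)]
  · rw [L2.inner_def]
    refine integral_congr_ae ?_
    filter_upwards [inverse_one_sub_smul_mulL2 ha ha1 hw ht.toLp, ht.coeFn_toLp, hs.coeFn_toLp]
      with x h1 h2 h3
    rw [h1, h2, h3, RCLike.inner_apply]
    simp only [t, s]
    by_cases h0 : g x = 0
    · simp [h0]
    · have : (Real.sqrt ‖g x‖ : ℂ) ≠ 0 := by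
        simpa [Real.sqrt_eq_zero (norm_nonneg _)] using h0
      have h4 : (starRingEnd ℂ) (Real.sqrt ‖g x‖ : ℂ) = Real.sqrt ‖g x‖ := Complex.conj_ofReal _
      rw [h4]
      field_simp

end Multiplication

/-! ### Cauchy transforms and the backward shift -/

theorem cauchyTransform_withDensityᵥ {m : Measure UnitCircle} {g : UnitCircle → ℂ}
    (hg : Integrable g m) {w : ℂ} (hw : w ∈ unitDisk) :
    cauchyTransform (m.withDensityᵥ g) w =
      ∫ ζ : UnitCircle, 1 / (1 - w * starRingEnd ℂ (ζ : ℂ)) * g ζ ∂m :=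
  integral_withDensityᵥ hg (integrable_variation _ (cauchyKernel w hw))

/-- Every Cauchy transform is a resolvent matrix entry of a unitary operator, with
`‖φ‖ ‖ψ‖ = ‖μ‖`. -/
theorem exists_unitary_inner_eq_cauchyTransform (μ : ComplexMeasure UnitCircle) :
    ∃ (H : Type u) (_ : NormedAddCommGroup H) (_ : InnerProductSpace ℂ H)
      (_ : CompleteSpace H) (_ : TopologicalSpace.SeparableSpace H)
      (φ ψ : H) (U : H →L[ℂ] H), U ∈ unitary (H →L[ℂ] H) ∧
      ‖φ‖ * ‖ψ‖ = totalVariationNorm μ ∧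
      ∀ w ∈ unitDisk, inner ℂ ψ (Ring.inverse (1 - w • U) φ) = cauchyTransform μ w := by
  obtain ⟨g, hg, hμ⟩ := exists_eq_withDensityᵥ μ
  let e : ULift.{u} UnitCircle ≃ᵐ UnitCircle := MeasurableEquiv.ulift
  -- the measure is transported to a copy of the circle in the required universe
  let m : Measure (ULift.{u} UnitCircle) := μ.variation.map e.symm
  have : IsFiniteMeasure m := Measure.isFiniteMeasure_map _ _
  let a : ULift.{u} UnitCircle → ℂ := fun x => conjCoord (e x)
  have ha1 (x) : ‖a x‖ = 1 := by
    simp [a, conjCoord]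
  have ha : MemLp a ⊤ m := memLp_top_of_bound
    (conjCoord.continuous.measurable.comp e.measurable).aestronglyMeasurable 1
    (by filter_upwards with x using (ha1 x).le)
  have hg' : Integrable (g ∘ e) m := by
    rw [integrable_map_equiv]
    simpa [Function.comp_def] using hg
  -- needed for separability of `L²`
  have : Fact ((2 : ENNReal) ≠ ⊤) := ⟨by simp⟩
  obtain ⟨φ, ψ, hn, hw⟩ := exists_inner_inverse_mulL2 ha ha1 hg'
  refine ⟨Lp ℂ 2 m, inferInstance, inferInstance, inferInstance, inferInstance, φ, ψ, mulL2 ha,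
    mulL2_mem_unitary ha ha1, ?_, fun w hwD => ?_⟩
  · rw [hn, integral_map_equiv]
    conv_rhs => rw [hμ]
    rw [totalVariationNorm_withDensityᵥ hg]
    simp
  · rw [hw w hwD, integral_map_equiv]
    conv_rhs => rw [hμ]
    rw [cauchyTransform_withDensityᵥ hg hwD]
    simp [a, conjCoord]

theorem continuousAt_cauchyTransform_zero (μ : ComplexMeasure UnitCircle) :
    ContinuousAt (cauchyTransform μ) 0 := by
  obtain ⟨g, hg, hμ⟩ := exists_eq_withDensityᵥ μ
  have hD : unitDisk ∈ nhds (0 : ℂ) := Metric.ball_mem_nhds _ one_pos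
  have h1 : ContinuousAt (fun w : ℂ => ∫ ζ : UnitCircle,
      1 / (1 - w * starRingEnd ℂ (ζ : ℂ)) * g ζ ∂μ.variation) 0 := by
    refine continuousAt_of_dominated (bound := fun ζ => 2 * ‖g ζ‖) ?_ ?_ (hg.norm.const_mul 2) ?_
    · filter_upwards [hD] with w hw
      exact (cauchyKernel w hw).continuous.aestronglyMeasurable.mul hg.aestronglyMeasurable
    · filter_upwards [Metric.ball_mem_nhds (0 : ℂ) (show (0 : ℝ) < 1 / 2 by norm_num)] with w hw
      filter_upwards with ζ
      rw [norm_mul]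
      gcongr
      have h2 : ‖w * starRingEnd ℂ (ζ : ℂ)‖ ≤ 1 / 2 := by
        have : ‖w‖ < 1 / 2 := by simpa using hw
        simpa using this.le
      have h3 : 1 / 2 ≤ ‖1 - w * starRingEnd ℂ (ζ : ℂ)‖ := by
        have := norm_sub_norm_le (1 : ℂ) (w * starRingEnd ℂ (ζ : ℂ))
        rw [norm_one] at this
        linarith
      rw [norm_div, norm_one]
      exact (one_div_le_one_div_of_le (by norm_num) h3).trans (by norm_num)
    · filter_upwards with ζ
      refine ContinuousAt.mul ?_ continuousAt_const
      refine continuousAt_const.div (by fun_prop) (by simp)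
  refine h1.congr ?_
  filter_upwards [hD] with w hw
  rw [← cauchyTransform_withDensityᵥ hg hw, ← hμ]

/-- It suffices to represent `Bh` off the origin, because `Kν` is continuous there. -/
theorem mem_representingMeasures_backwardShift {h : ℂ → ℂ} (hol : DifferentiableOn ℂ h unitDisk)
    {ν : ComplexMeasure UnitCircle}
    (hν : ∀ w ∈ unitDisk, w ≠ 0 → (h w - h 0) / w = cauchyTransform ν w) :
    ν ∈ representingMeasures (backwardShift h) := by
  intro w hw
  by_cases h0 : w = 0
  · subst h0
    have hD : unitDisk ∈ nhds (0 : ℂ) := Metric.ball_mem_nhds _ one_pos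
    have h1 := hasDerivAt_iff_tendsto_slope.1 (hol.differentiableAt hD).hasDerivAt
    have h2 := (continuousAt_cauchyTransform_zero ν).tendsto.mono_left
      (nhdsWithin_le_nhds (s := {0}ᶜ))
    rw [backwardShift, if_pos rfl]
    refine tendsto_nhds_unique h1 (h2.congr' ?_)
    filter_upwards [self_mem_nhdsWithin, mem_nhdsWithin_of_mem_nhds hD] with z hz hzD
    rw [← hν z hzD hz, slope_def_field, sub_zero]
  · rw [backwardShift, if_neg h0, hν w hw h0]

theorem differentiableOn_backwardShift {h : ℂ → ℂ} (hol : DifferentiableOn ℂ h unitDisk) :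
    DifferentiableOn ℂ (backwardShift h) unitDisk := by
  have h1 : backwardShift h = dslope h 0 := by
    funext w
    by_cases h0 : w = 0
    · simp [backwardShift, h0]
    · simp [backwardShift, h0, dslope_of_ne, slope_def_field]
  rw [h1, Complex.differentiableOn_dslope (Metric.ball_mem_nhds _ one_pos)]
  exact hol

/-- If `h = Kμ`, then `Bh = K(conj ζ · μ)`. -/
theorem representingMeasures_backwardShift_nonempty {h : ℂ → ℂ}
    (hol : DifferentiableOn ℂ h unitDisk) (hne : (representingMeasures h).Nonempty) :
    (representingMeasures (backwardShift h)).Nonempty := by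
  obtain ⟨μ, hμ⟩ := hne
  obtain ⟨g, hg, e⟩ := exists_eq_withDensityᵥ μ
  have hb : Integrable (fun ζ => conjCoord ζ * g ζ) μ.variation :=
    hg.bdd_mul conjCoord.continuous.aestronglyMeasurable
      (by filter_upwards with x using conjCoord.norm_coe_le_norm x)
  have hK {w : ℂ} (hw : w ∈ unitDisk) : Integrable
      (fun ζ : UnitCircle => 1 / (1 - w * starRingEnd ℂ (ζ : ℂ)) * g ζ) μ.variation :=
    hg.bdd_mul (cauchyKernel w hw).continuous.aestronglyMeasurable
      (by filter_upwards with x using (cauchyKernel w hw).norm_coe_le_norm x)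
  have h0 : (0 : ℂ) ∈ unitDisk := by simp
  refine ⟨_, mem_representingMeasures_backwardShift hol
    (ν := μ.variation.withDensityᵥ fun ζ => conjCoord ζ * g ζ) fun w hw hw0 => ?_⟩
  rw [hμ w hw, hμ 0 h0, e, cauchyTransform_withDensityᵥ hg hw, cauchyTransform_withDensityᵥ hg h0,
    ← e, cauchyTransform_withDensityᵥ hb hw, ← integral_sub (hK hw) (hK h0), ← integral_div]
  congr 1
  ext ζ
  have := one_sub_mul_conj_ne_zero hw ζ
  simp only [conjCoord, ContinuousMap.coe_mk]
  field_simp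
  ring

theorem cauchyTransform_add (μ ν : ComplexMeasure UnitCircle) {w : ℂ} (hw : w ∈ unitDisk) :
    cauchyTransform (μ + ν) w = cauchyTransform μ w + cauchyTransform ν w :=
  VectorMeasure.integral_add_vectorMeasure (integrable_variation μ (cauchyKernel w hw))
    (integrable_variation ν (cauchyKernel w hw))

theorem cauchyTransform_smul (c : ℂ) (μ : ComplexMeasure UnitCircle) {w : ℂ}
    (hw : w ∈ unitDisk) : cauchyTransform (c • μ) w = c * cauchyTransform μ w := by
  obtain ⟨g, hg, e⟩ := exists_eq_withDensityᵥ μ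
  have h1 : c • μ = μ.variation.withDensityᵥ (c • g) := by
    rw [withDensityᵥ_smul, ← e]
  rw [h1, cauchyTransform_withDensityᵥ (hg.smul c) hw]
  conv_rhs => rw [e]
  rw [cauchyTransform_withDensityᵥ hg hw, ← integral_const_mul]
  congr 1
  ext ζ
  simp only [Pi.smul_apply, smul_eq_mul]
  ring

/-- The constant function `1` is a Cauchy transform, being the resolvent matrix entry of the
zero operator on `ℂ`. -/
theorem exists_cauchyTransform_eq_one :
    ∃ ν : ComplexMeasure UnitCircle, ∀ w ∈ unitDisk, cauchyTransform ν w = 1 := by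
  obtain ⟨ν, hν, -⟩ := exists_cauchyTransform_eq_inner (A := (0 : ℂ →L[ℂ] ℂ)) (by simp) 1 1
  exact ⟨ν, fun w hw => by rw [← hν w hw]; simp⟩

/-- Multiplication by `w` preserves Cauchy transforms up to a constant, as
`w / (1 - w conj ζ) = ζ / (1 - w conj ζ) - ζ` on the circle. -/
theorem exists_cauchyTransform_eq_mul (ν : ComplexMeasure UnitCircle) :
    ∃ (ν' : ComplexMeasure UnitCircle) (c : ℂ), ∀ w ∈ unitDisk,
      w * cauchyTransform ν w = cauchyTransform ν' w - c := by
  obtain ⟨g, hg, e⟩ := exists_eq_withDensityᵥ ν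
  have hb : Integrable (fun ζ : UnitCircle => star conjCoord ζ * g ζ) ν.variation :=
    hg.bdd_mul (star conjCoord).continuous.aestronglyMeasurable
      (by filter_upwards with x using (star conjCoord).norm_coe_le_norm x)
  refine ⟨ν.variation.withDensityᵥ fun ζ => star conjCoord ζ * g ζ,
    ∫ ζ, star conjCoord ζ * g ζ ∂ν.variation, fun w hw => ?_⟩
  conv_lhs => rw [e]
  have hK : Integrable (fun ζ : UnitCircle => 1 / (1 - w * starRingEnd ℂ (ζ : ℂ)) *
      (star conjCoord ζ * g ζ)) ν.variation :=
    hb.bdd_mul (cauchyKernel w hw).continuous.aestronglyMeasurable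
      (by filter_upwards with x using (cauchyKernel w hw).norm_coe_le_norm x)
  rw [cauchyTransform_withDensityᵥ hg hw, cauchyTransform_withDensityᵥ hb hw,
    ← integral_const_mul, ← integral_sub hK hb]
  congr 1
  ext ζ
  have hne := one_sub_mul_conj_ne_zero hw ζ
  have h1 : star conjCoord ζ = (ζ : ℂ) := Complex.conj_conj _
  have h2 : (ζ : ℂ) * starRingEnd ℂ (ζ : ℂ) = 1 := by
    rw [RCLike.mul_conj]; simp
  rw [h1]
  field_simp
  linear_combination (-w * g ζ) * h2

/-- If `Bh = Kν`, then `h = h(0) · 1 + w Kν` is a Cauchy transform. -/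
theorem mem_cauchySpace_of_backwardShift {h : ℂ → ℂ} (hol : DifferentiableOn ℂ h unitDisk)
    (hne : (representingMeasures (backwardShift h)).Nonempty) : h ∈ cauchySpace := by
  obtain ⟨ν, hν⟩ := hne
  obtain ⟨ν₁, h₁⟩ := exists_cauchyTransform_eq_one
  obtain ⟨ν₂, c, h₂⟩ := exists_cauchyTransform_eq_mul ν
  refine ⟨hol, (h 0 - c) • ν₁ + ν₂, fun w hw => ?_⟩
  have h3 : h w = h 0 + w * backwardShift h w := by
    by_cases h0 : w = 0
    · simp [h0]
    · rw [backwardShift, if_neg h0]; field_simp; ring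
  rw [cauchyTransform_add _ _ hw, cauchyTransform_smul _ _ hw, h₁ w hw, h3, hν w hw, h₂ w hw]
  ring

/-! ### Resolvent representations -/

theorem exists_mem_representingMeasures_of_isRepresentedBy {H : Type*} [NormedAddCommGroup H]
    [InnerProductSpace ℂ H] [CompleteSpace H] {h : ℂ → ℂ} (hol : DifferentiableOn ℂ h unitDisk)
    {A : H →L[ℂ] H} (hA : ‖A‖ ≤ 1) {φ ψ : H} (hr : IsRepresentedBy h A φ ψ) :
    ∃ ν ∈ representingMeasures (backwardShift h), totalVariationNorm ν ≤ ‖φ‖ * ‖ψ‖ := by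
  obtain ⟨ν, hν, hn⟩ := exists_cauchyTransform_eq_inner hA φ ψ
  refine ⟨ν, mem_representingMeasures_backwardShift hol fun w hw h0 => ?_, hn⟩
  rw [hr w hw, hr 0 (by simp), ← hν w hw]
  field_simp
  ring

theorem cauchyNorm_le {h : ℂ → ℂ} {ν : ComplexMeasure UnitCircle}
    (hν : ν ∈ representingMeasures h) : cauchyNorm h ≤ totalVariationNorm ν :=
  csInf_le ⟨0, by rintro _ ⟨μ, -, rfl⟩; exact ENNReal.toReal_nonneg⟩ ⟨ν, hν, rfl⟩

/-- A representing measure of `Bh` of least total variation gives a unitary representation of `h`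
attaining the minimum. -/
theorem exists_unitary_isRepresentedBy {h : ℂ → ℂ} (h0 : h 0 = 1)
    (hne : (representingMeasures (backwardShift h)).Nonempty) :
    ∃ (H : Type u) (_ : NormedAddCommGroup H) (_ : InnerProductSpace ℂ H)
      (_ : CompleteSpace H) (_ : TopologicalSpace.SeparableSpace H)
      (φ ψ : H) (U : H →L[ℂ] H), U ∈ unitary (H →L[ℂ] H) ∧ IsRepresentedBy h U φ ψ ∧
      cauchyNorm (backwardShift h) = ‖φ‖ * ‖ψ‖ := by
  obtain ⟨μ, hμ, hn⟩ := exists_totalVariationNorm_eq_cauchyNorm hne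
  obtain ⟨H, i₁, i₂, i₃, i₄, φ, ψ, U, hU, hφψ, hK⟩ := exists_unitary_inner_eq_cauchyTransform.{u} μ
  refine ⟨H, i₁, i₂, i₃, i₄, φ, ψ, U, hU, fun w hw => ?_, by rw [hφψ, hn]⟩
  rw [hK w hw, ← hμ w hw]
  by_cases hw0 : w = 0
  · simp [hw0, h0]
  · rw [backwardShift, if_neg hw0, h0]; field_simp; ring

end

theorem theorem4 (h : ℂ → ℂ) (hol : DifferentiableOn ℂ h unitDisk) (h0 : h 0 = 1) :
    List.TFAE
      [h ∈ cauchySpace,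
       ∃ (H : Type u) (_ : NormedAddCommGroup H) (_ : InnerProductSpace ℂ H)
         (_ : CompleteSpace H) (_ : TopologicalSpace.SeparableSpace H)
         (φ ψ : H) (A : H →L[ℂ] H), ‖A‖ ≤ 1 ∧ IsRepresentedBy h A φ ψ,
       ∃ (H : Type u) (_ : NormedAddCommGroup H) (_ : InnerProductSpace ℂ H)
         (_ : CompleteSpace H) (_ : TopologicalSpace.SeparableSpace H)
         (φ ψ : H) (U : H →L[ℂ] H), U ∈ unitary (H →L[ℂ] H) ∧ IsRepresentedBy h U φ ψ] ∧
    (h ∈ cauchySpace →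
      backwardShift h ∈ cauchySpace ∧
      IsLeast
        {r : ℝ | ∃ (H : Type u) (_ : NormedAddCommGroup H) (_ : InnerProductSpace ℂ H)
          (_ : CompleteSpace H) (_ : TopologicalSpace.SeparableSpace H)
          (φ ψ : H) (A : H →L[ℂ] H),
          ‖A‖ ≤ 1 ∧ IsRepresentedBy h A φ ψ ∧ r = ‖φ‖ * ‖ψ‖}
        (cauchyNorm (backwardShift h)) ∧
      IsLeast
        {r : ℝ | ∃ (H : Type u) (_ : NormedAddCommGroup H) (_ : InnerProductSpace ℂ H)
          (_ : CompleteSpace H) (_ : TopologicalSpace.SeparableSpace H)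
          (φ ψ : H) (U : H →L[ℂ] H),
          U ∈ unitary (H →L[ℂ] H) ∧ IsRepresentedBy h U φ ψ ∧ r = ‖φ‖ * ‖ψ‖}
        (cauchyNorm (backwardShift h))) := by
  -- minimality: every representation bounds the norm of `Bh`
  have hlower {H : Type u} [NormedAddCommGroup H] [InnerProductSpace ℂ H] [CompleteSpace H]
      {A : H →L[ℂ] H} (hA : ‖A‖ ≤ 1) {φ ψ : H} (hr : IsRepresentedBy h A φ ψ) :
      cauchyNorm (backwardShift h) ≤ ‖φ‖ * ‖ψ‖ := by
    obtain ⟨ν, hν, hn⟩ := exists_mem_representingMeasures_of_isRepresentedBy hol hA hr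
    exact (cauchyNorm_le hν).trans hn
  refine ⟨?_, fun hh => ?_⟩
  · tfae_have 1 → 3 := fun hh => by
      obtain ⟨H, i₁, i₂, i₃, i₄, φ, ψ, U, hU, hr, -⟩ := exists_unitary_isRepresentedBy.{u} h0
        (representingMeasures_backwardShift_nonempty hol hh.2)
      exact ⟨H, i₁, i₂, i₃, i₄, φ, ψ, U, hU, hr⟩
    tfae_have 3 → 2 := fun ⟨H, i₁, i₂, i₃, i₄, φ, ψ, U, hU, hr⟩ =>
      ⟨H, i₁, i₂, i₃, i₄, φ, ψ, U, norm_le_one_of_mem_unitary hU, hr⟩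
    tfae_have 2 → 1 := fun ⟨H, i₁, i₂, i₃, i₄, φ, ψ, A, hA, hr⟩ => by
      obtain ⟨ν, hν, -⟩ := exists_mem_representingMeasures_of_isRepresentedBy hol hA hr
      exact mem_cauchySpace_of_backwardShift hol ⟨ν, hν⟩
    tfae_finish
  · have hne := representingMeasures_backwardShift_nonempty hol hh.2
    obtain ⟨H, i₁, i₂, i₃, i₄, φ, ψ, U, hU, hr, hn⟩ := exists_unitary_isRepresentedBy.{u} h0 hne
    refine ⟨⟨differentiableOn_backwardShift hol, hne⟩, ⟨?_, ?_⟩, ?_, ?_⟩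
    · exact ⟨H, i₁, i₂, i₃, i₄, φ, ψ, U, norm_le_one_of_mem_unitary hU, hr, hn⟩
    · rintro _ ⟨H, _, _, _, _, φ, ψ, A, hA, hr, rfl⟩
      exact hlower hA hr
    · exact ⟨H, i₁, i₂, i₃, i₄, φ, ψ, U, hU, hr, hn⟩
    · rintro _ ⟨H, _, _, _, _, φ, ψ, U, hU, hr, rfl⟩
      exact hlower (norm_le_one_of_mem_unitary hU) hr
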